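/- A convergent power series $\hat\varphi\in\mathbb C\{\zeta\}$ is *endlessly continuable* if for every real $L>0$ there is a finite set $F_L\subset\mathbb C$ such that $\hat\varphi$ can be analytically continued along every Lipschitz path $\gamma:[0,1]\to\mathbb C$ of length $<L$ with $\gamma(0)=0$ and $\gamma((0,1])\subset\mathbb C\setminus F_L$. Let $\hat{\mathscr R}$ be the set of these series. A *discrete filtered set* is a family $\Omega=(\Omega_L)_{L\in\mathbb R_{\ge0}}$ of finite subsets of $\mathbb C$ such that $\Omega_{L_1}\subseteq\Omega_{L_2}$ whenever $L_1\le L_2$, and $\Omega_\delta=\emptyset$ for some $\delta>0$. Let $\mathcal S_\Omega=\{(\lambda,\omega)\in\mathbb R_{\ge0}\times\mathbb C : \omega\in\Omega_\lambda\}$ and let $\mathcal M_\Omega=(\mathbb R_{\ge0}\times\mathbb C)\setminus\overline{\mathcal S_\Omega}$, the closure being taken in $\mathbb R_{\ge0}\times\mathbb C$. A Lipschitz path $\gamma:[0,t_*]\to\mathbb C$ with $t_*\ge0$ and $\gamma(0)=0$ is *$\Omega$-allowed* if $(L(\gamma|_{[0,t]}),\gamma(t))\in\mathcal M_\Omega$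 for all $t\in[0,t_*]$, where $L(\cdot)$ denotes the length. A convergent power series is *$\Omega$-continuable* if it can be analytically continued along every $\Omega$-allowed path. Let $\hat{\mathscr R}_\Omega$ be the set of these series. For a formal series $\tilde\varphi=\sum_{j\ge0}\varphi_jz^j\in\mathbb C[[z]]$ put $\hat\varphi(\zeta)=\sum_{j\ge1}\varphi_j\,\zeta^{j-1}/(j-1)!$ (the formal Borel transform of $\tilde\varphi-\varphi_0$). The series $\tilde\varphi$ is *resurgent* if $\hat\varphi\in\hat{\mathscr R}$, and *$\Omega$-resurgent* if $\hat\varphi\in\hat{\mathscr R}_\Omega$. **Proposition.** A formal series $\tilde\varphi\in\mathbb C[[z]]$ is resurgent if and only if there exists a discrete filtered set $\Omega$ such that $\tilde\varphi$ is $\Omega$-resurgent. Correspondingly, $$\hat{\mathscr R}=\bigcup_{\Omega}\hat{\mathscr R}_\Omega,$$ where $\Omega$ runs over all discrete filtered sets. -/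

import Mathlib

open Set Filter Topology
open scoped NNReal ENNReal PowerSeries

noncomputable section

namespace Resurgence

/-- The power series `φ` viewed as a Mathlib formal multilinear series `∑ φₙ ζⁿ` on `ℂ`. -/
def toFMS (φ : ℂ⟦X⟧) : FormalMultilinearSeries ℂ ℂ ℂ :=
  FormalMultilinearSeries.ofScalars ℂ (fun n => PowerSeries.coeff n φ)

/-- `φ ∈ ℂ{ζ}`: the radius of convergence is positive. -/
def IsConvergent (φ : ℂ⟦X⟧) : Prop := 0 < (toFMS φ).radius

/-- The sum of `φ`, meaningful on the disc of convergence. -/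
def evalSum (φ : ℂ⟦X⟧) : ℂ → ℂ := (toFMS φ).sum

/-- A Lipschitz path `γ : [0, T] → ℂ` with `T ≥ 0` and `γ 0 = 0`. The values of `toFun` outside
`[0, T]` are irrelevant. -/
structure LipPath where
  T : ℝ
  T_nonneg : 0 ≤ T
  toFun : ℝ → ℂ
  lipschitz : ∃ K : ℝ≥0, LipschitzOnWith K toFun (Icc 0 T)
  map_zero : toFun 0 = 0

/-- The length of the restriction of `γ` to `[0, t]`, for `t ∈ [0, T]`
(finite, since `γ` is Lipschitz). -/
def LipPath.lengthUpTo (γ : LipPath) (t : ℝ) : ℝ≥0 :=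
  (eVariationOn γ.toFun (Icc 0 t)).toNNReal

/-- The total length of `γ`. -/
def LipPath.length (γ : LipPath) : ℝ≥0 := γ.lengthUpTo γ.T

/-- The germ at `0` defined by `φ` can be analytically continued along `γ`: there are germs `F t` of
analytic functions at `γ t`, starting with `φ`, such that for `s` close to `t` the germ `F s`
is the one induced by `F t` at `γ s`. -/
def ContinuableAlong (φ : ℂ⟦X⟧) (γ : LipPath) : Prop :=
  ∃ F : ℝ → ℂ → ℂ,
    (∀ t ∈ Icc 0 γ.T, AnalyticAt ℂ (F t) (γ.toFun t)) ∧
    F 0 =ᶠ[𝓝 0] evalSum φ ∧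
    ∀ t ∈ Icc 0 γ.T, ∀ᶠ s in 𝓝[Icc 0 γ.T] t, F s =ᶠ[𝓝 (γ.toFun s)] F t

/-- Endlessly continuable functions. -/
def EndlesslyContinuable : Set ℂ⟦X⟧ :=
  {φ | IsConvergent φ ∧
    ∀ L : ℝ, 0 < L → ∃ F : Set ℂ, F.Finite ∧
      ∀ γ : LipPath, γ.T = 1 → (γ.length : ℝ) < L →
        (∀ t ∈ Ioc (0 : ℝ) 1, γ.toFun t ∉ F) → ContinuableAlong φ γ}

/-- Discrete filtered sets. -/
structure DiscreteFilteredSet where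
  carrier : ℝ≥0 → Set ℂ
  finite : ∀ L, (carrier L).Finite
  mono : ∀ L₁ L₂, L₁ ≤ L₂ → carrier L₁ ⊆ carrier L₂
  exists_empty : ∃ δ : ℝ≥0, 0 < δ ∧ carrier δ = ∅

/-- The set of all `(l, ω)` with `ω ∈ Ω_l`, as a subset of `ℝ≥0 × ℂ`. -/
def DiscreteFilteredSet.graph (Ω : DiscreteFilteredSet) : Set (ℝ≥0 × ℂ) :=
  {p | p.2 ∈ Ω.carrier p.1}

/-- The allowed open set: the complement in `ℝ≥0 × ℂ` of the closure of `graph`. -/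
def DiscreteFilteredSet.allowed (Ω : DiscreteFilteredSet) : Set (ℝ≥0 × ℂ) :=
  (closure Ω.graph)ᶜ

/-- `Ω`-allowed paths. -/
def DiscreteFilteredSet.AllowedPath (Ω : DiscreteFilteredSet) (γ : LipPath) : Prop :=
  ∀ t ∈ Icc 0 γ.T, (γ.lengthUpTo t, γ.toFun t) ∈ Ω.allowed

/-- `Ω`-continuable functions. -/
def Continuable (Ω : DiscreteFilteredSet) : Set ℂ⟦X⟧ :=
  {φ | IsConvergent φ ∧ ∀ γ : LipPath, Ω.AllowedPath γ → ContinuableAlong φ γ}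

/-- The formal Borel transform; the pair `(c, ψ)` stands for `c δ + ψ` in `ℂ δ ⊕ ℂ⟦ζ⟧`. -/
def borelTransform (φ : ℂ⟦X⟧) : ℂ × ℂ⟦X⟧ :=
  (PowerSeries.coeff 0 φ, PowerSeries.mk fun j => PowerSeries.coeff (j + 1) φ / (Nat.factorial j : ℂ))

/-- Resurgent series. -/
def Resurgent : Set ℂ⟦X⟧ := borelTransform ⁻¹' (univ ×ˢ EndlesslyContinuable)

/-- `Ω`-resurgent series. -/
def ResurgentFor (Ω : DiscreteFilteredSet) : Set ℂ⟦X⟧ := borelTransform ⁻¹' (univ ×ˢ Continuable Ω)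

end Resurgence

end

open Set Filter Topology
open scoped NNReal ENNReal PowerSeries

noncomputable section

namespace Resurgence

/-! Given `Ω`, take `Ω_L` as the finite set for `L`: by monotonicity the closure of the graph of `Ω`
lies over `Ω_L` at every level below `L`, so a path of length `< L` avoiding `Ω_L` is allowed.

Conversely, let `S k` be the finite set for `L = k`, let `φ` be analytic on the disc of radius `δ`,
and let `Ω_L` be empty for `L < δ` and the union of the `S k` with `k ≤ ⌊L⌋ + 2` otherwise. An
allowed path of current length `l ≥ δ` is then off `S N`, `N = ⌊l⌋ + 2`, but it may have met `S N`
earlier, when fewer points were forbidden; the hypothesis for `N` does not apply to it directly. The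
remedy is a perturbation: the germ already continued along the path is also reached along a path
that avoids `S N` and is barely longer (`Reaches.of_continuation`, by `exists_detour`). Appending
segments to that path stays below length `N`, so the germ extends to a disc free of `S N`
(`Reaches.exists_extension`), and the continuation advances by a uniform step near each time.
`forward_induction_Icc` turns this local progress into continuation along the whole path. -/

/-! ### Continuous induction and germs along a path -/

/-- Continuous induction on a compact interval: a property which holds at the left end point and
locally propagates to the right holds everywhere. -/
theorem forward_induction_Icc {a b : ℝ} {P : ℝ → Prop} (ha : P a)
    (h : ∀ t ∈ Icc a b, ∃ V ∈ 𝓝[Icc a b] t, ∀ s ∈ V, ∀ s' ∈ V, s ∈ Icc a b → s' ∈ Icc a b →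
      s ≤ s' → P s → P s') :
    ∀ t ∈ Icc a b, P t := by
  intro t ht
  have hat : a ≤ t := ht.1
  have h' : ∀ x : Icc a t, ∃ U : Set (Icc a t), IsOpen U ∧ x ∈ U ∧
      ∀ s ∈ U, ∀ s' ∈ U, s ≤ s' → P s → P s' := by
    intro x
    obtain ⟨V, hV, hP⟩ := h x ⟨x.2.1, x.2.2.trans ht.2⟩
    obtain ⟨W, hWo, hxW, hWV⟩ := mem_nhdsWithin.1 hV
    have hmem : ∀ y : Icc a t, (y : ℝ) ∈ Icc a b := fun y => ⟨y.2.1, y.2.2.trans ht.2⟩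
    exact ⟨Subtype.val ⁻¹' W, hWo.preimage continuous_subtype_val, hxW,
      fun s hs s' hs' hss' => hP s (hWV ⟨hs, hmem s⟩) s' (hWV ⟨hs', hmem s'⟩) (hmem s) (hmem s')
        hss'⟩
  choose U hUo hxU hU using h'
  -- By compactness, finitely many steps suffice, each inside one set on which `P` propagates to the
  -- right.
  obtain ⟨u, hu0, humono, ⟨m, hm⟩, hcov⟩ := exists_monotone_Icc_subset_open_cover_Icc hat hUo
    (fun x _ => mem_iUnion.2 ⟨x, hxU x⟩)
  have key : ∀ n, P (u n) := by
    intro n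
    induction n with
    | zero => rwa [hu0]
    | succ n ih =>
      obtain ⟨i, hi⟩ := hcov n
      have hle := humono n.le_succ
      exact hU i _ (hi ⟨le_rfl, hle⟩) _ (hi ⟨hle, le_rfl⟩) hle ih
  simpa [hm m le_rfl] using key m

/-- Two analytic functions on a preconnected open set with the same germ at one point have the
same germ at every point. -/
theorem eventuallyEq_of_preconnected {f g : ℂ → ℂ} {U : Set ℂ} (hU : IsOpen U)
    (hc : IsPreconnected U) (hf : AnalyticOnNhd ℂ f U) (hg : AnalyticOnNhd ℂ g U) {x y : ℂ}
    (hx : x ∈ U) (hy : y ∈ U) (h : f =ᶠ[𝓝 x] g) : f =ᶠ[𝓝 y] g :=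
  (hf.eqOn_of_preconnected_of_eventuallyEq hg hc hx h).eventuallyEq_of_mem (hU.mem_nhds hy)

theorem eventually_mem_ball_of_continuousOn {c : ℝ → ℂ} {I : Set ℝ} (hc : ContinuousOn c I) {t : ℝ}
    (ht : t ∈ I) {r : ℝ} (hr : 0 < r) : ∀ᶠ s in 𝓝[I] t, c s ∈ Metric.ball (c t) r :=
  (hc t ht).eventually (Metric.ball_mem_nhds _ hr)

/-- `F` is a family of germs at the points of the path `c` on `[a, b]`, each obtained from the
neighbouring ones by analytic continuation. -/
structure IsGermContinuation (c : ℝ → ℂ) (a b : ℝ) (F : ℝ → ℂ → ℂ) : Prop where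
  analyticAt : ∀ t ∈ Icc a b, AnalyticAt ℂ (F t) (c t)
  eventually_eq : ∀ t ∈ Icc a b, ∀ᶠ s in 𝓝[Icc a b] t, F s =ᶠ[𝓝 (c s)] F t

namespace IsGermContinuation

variable {c : ℝ → ℂ} {a b : ℝ} {F G : ℝ → ℂ → ℂ}

theorem mono (h : IsGermContinuation c a b F) {a' b' : ℝ} (ha : a ≤ a') (hb : b' ≤ b) :
    IsGermContinuation c a' b' F :=
  have hs : Icc a' b' ⊆ Icc a b := Icc_subset_Icc ha hb
  ⟨fun t ht => h.analyticAt t (hs ht),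
    fun t ht => (h.eventually_eq t (hs ht)).filter_mono (nhdsWithin_mono _ hs)⟩

theorem const {g : ℂ → ℂ} (hg : ∀ t ∈ Icc a b, AnalyticAt ℂ g (c t)) :
    IsGermContinuation c a b fun _ => g :=
  ⟨hg, fun _ _ => Eventually.of_forall fun _ => EventuallyEq.rfl⟩

/-- Uniqueness of analytic continuation along a path. -/
theorem unique (hc : ContinuousOn c (Icc a b)) (hF : IsGermContinuation c a b F)
    (hG : IsGermContinuation c a b G) (h0 : F a =ᶠ[𝓝 (c a)] G a) :
    ∀ t ∈ Icc a b, F t =ᶠ[𝓝 (c t)] G t := by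
  refine forward_induction_Icc h0 fun t ht => ?_
  obtain ⟨r, hr, hFr⟩ := (hF.analyticAt t ht).exists_ball_analyticOnNhd
  obtain ⟨r', hr', hGr⟩ := (hG.analyticAt t ht).exists_ball_analyticOnNhd
  refine ⟨_, ((eventually_mem_ball_of_continuousOn hc ht (lt_min hr hr')).and
    ((hF.eventually_eq t ht).and (hG.eventually_eq t ht))), ?_⟩
  rintro s ⟨hs, hFs, hGs⟩ s' ⟨hs', hFs', hGs'⟩ - - - hP
  have := eventuallyEq_of_preconnected Metric.isOpen_ball
    (convex_ball _ _).isPreconnected (hFr.mono (Metric.ball_subset_ball (min_le_left r r')))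
    (hGr.mono (Metric.ball_subset_ball (min_le_right r r'))) hs hs' (hFs.symm.trans (hP.trans hGs))
  exact hFs'.trans (this.trans hGs'.symm)

/-- Concatenation of continuations along adjacent pieces of a path. -/
theorem concat {d : ℝ} (hc : ContinuousOn c (Icc a d)) (hF : IsGermContinuation c a b F)
    (hG : IsGermContinuation c b d G) (h : F b =ᶠ[𝓝 (c b)] G b) :
    IsGermContinuation c a d fun t => if t ≤ b then F t else G t := by
  constructor
  · intro t ht
    by_cases htb : t ≤ b
    · simpa only [if_pos htb] using hF.analyticAt t ⟨ht.1, htb⟩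
    · simpa only [if_neg htb] using hG.analyticAt t ⟨(not_le.1 htb).le, ht.2⟩
  · intro t ht
    rcases lt_trichotomy t b with htb | htb | htb
    · have h1 := hF.eventually_eq t ⟨ht.1, htb.le⟩
      rw [eventually_nhdsWithin_iff] at h1 ⊢
      filter_upwards [h1, eventually_lt_nhds htb] with s hs hsb hsI
      simpa only [if_pos htb.le, if_pos hsb.le] using hs ⟨hsI.1, hsb.le⟩
    · subst htb
      have h1 := hF.eventually_eq t ⟨ht.1, le_rfl⟩
      have h2 := hG.eventually_eq t ⟨le_rfl, ht.2⟩
      -- Equality of germs is an open condition, so agreement at the junction persists at nearby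
      -- points of the path.
      have h3 := (hc t ht).eventually (eventually_eventually_nhds.2 h)
      rw [eventually_nhdsWithin_iff] at h1 h2 h3 ⊢
      filter_upwards [h1, h2, h3] with s hs1 hs2 hs3 hsI
      by_cases hst : s ≤ t
      · simpa only [if_pos hst, if_pos le_rfl] using hs1 ⟨hsI.1, hst⟩
      · simp only [if_neg hst, if_pos le_rfl]
        exact (hs2 ⟨(not_le.1 hst).le, hsI.2⟩).trans (EventuallyEq.symm (hs3 hsI))
    · have h1 := hG.eventually_eq t ⟨htb.le, ht.2⟩
      rw [eventually_nhdsWithin_iff] at h1 ⊢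
      filter_upwards [h1, eventually_gt_nhds htb] with s hs hsb hsI
      simpa only [if_neg (not_le.2 htb), if_neg (not_le.2 hsb)] using hs ⟨hsb.le, hsI.2⟩

end IsGermContinuation

/-! ### From radial continuation to a disc -/

open AffineMap in
/-- A germ which can be continued along all rays of a disc extends to the disc. -/
theorem exists_analyticOnNhd_ball {g : ℂ → ℂ} {a : ℂ} {R : ℝ} (hR : 0 < R)
    (h : ∀ z ∈ Metric.ball a R, ∃ H : ℝ → ℂ → ℂ,
      IsGermContinuation (fun t : ℝ => lineMap a z t) 0 1 H ∧ H 0 =ᶠ[𝓝 a] g) :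
    ∃ G, AnalyticOnNhd ℂ G (Metric.ball a R) ∧ G =ᶠ[𝓝 a] g := by
  choose! H hH hH0 using h
  have hcw : ∀ t : ℝ, Continuous fun w : ℂ => (lineMap a w t : ℂ) := by
    intro t
    simp only [lineMap_apply_module']
    fun_prop
  have hct : ∀ w : ℂ, Continuous fun t : ℝ => (lineMap a w t : ℂ) := by
    intro w
    simp only [lineMap_apply_module']
    fun_prop
  -- Continuations along neighbouring rays agree at equal times; at time `1` this makes `w ↦ H w 1
  -- w` locally equal to the single germ `H z 1`, hence analytic.
  have key : ∀ z ∈ Metric.ball a R, ∀ t ∈ Icc (0 : ℝ) 1,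
      ∀ᶠ w in 𝓝 z, H w t =ᶠ[𝓝 (lineMap a w t)] H z t := by
    intro z hz
    refine forward_induction_Icc ?_ fun t ht => ?_
    · filter_upwards [Metric.isOpen_ball.mem_nhds hz] with w hw
      simpa only [lineMap_apply_zero] using (hH0 w hw).trans (hH0 z hz).symm
    · obtain ⟨r, hr, hFr⟩ := ((hH z hz).analyticAt t ht).exists_ball_analyticOnNhd
      refine ⟨_, (eventually_mem_ball_of_continuousOn (hct z).continuousOn ht hr).and
        ((hH z hz).eventually_eq t ht), ?_⟩
      rintro s ⟨hs, hFs⟩ s' ⟨hs', hFs'⟩ hsI hsI' hss' hP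
      filter_upwards [Metric.isOpen_ball.mem_nhds hz, hP,
        (hcw s).continuousAt.eventually (eventually_eventually_nhds.2 hFs),
        (hcw s').continuousAt.eventually (eventually_eventually_nhds.2 hFs'),
        (hcw s).continuousAt.eventually (Metric.isOpen_ball.mem_nhds hs),
        (hcw s').continuousAt.eventually (Metric.isOpen_ball.mem_nhds hs')] with
        w hw hPw h1 h1' h2 h2'
      -- Convexity of the disc keeps the ray to `w` inside it between times `s` and `s'`, so `H z t`
      -- continues itself there.
      have hord : (lineMap a w ⁻¹' Metric.ball (lineMap a z t : ℂ) r : Set ℝ).OrdConnected :=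
        ((convex_ball _ _).affine_preimage (lineMap a w)).ordConnected
      have hconst : IsGermContinuation (fun t : ℝ => (lineMap a w t : ℂ)) s s' fun _ => H z t :=
        IsGermContinuation.const fun σ hσ => hFr _ (hord.out h2 h2' hσ)
      have := IsGermContinuation.unique (hct w).continuousOn
        ((hH w hw).mono hsI.1 hsI'.2) hconst (hPw.trans h1) s' ⟨hss', le_rfl⟩
      exact this.trans (EventuallyEq.symm h1')
  have hev : ∀ z ∈ Metric.ball a R, (fun w => H w 1 w) =ᶠ[𝓝 z] H z 1 := by
    intro z hz
    filter_upwards [key z hz 1 ⟨zero_le_one, le_rfl⟩] with w hw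
    simpa only [lineMap_apply_one] using hw.self_of_nhds
  refine ⟨fun w => H w 1 w, fun z hz => ?_, ?_⟩
  · have := (hH z hz).analyticAt 1 ⟨zero_le_one, le_rfl⟩
    rw [lineMap_apply_one] at this
    exact this.congr (hev z hz).symm
  · have ha : a ∈ Metric.ball a R := Metric.mem_ball_self hR
    have h0 := (hH a ha).analyticAt 0 ⟨le_rfl, zero_le_one⟩
    have := IsGermContinuation.unique (hct a).continuousOn (hH a ha)
      (IsGermContinuation.const (g := H a 0) fun _ _ => by simpa using h0) EventuallyEq.rfl 1
      ⟨zero_le_one, le_rfl⟩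
    rw [lineMap_apply_one] at this
    exact (hev a ha).trans (this.trans (hH0 a ha))

/-! ### Length of Lipschitz paths, and appending a segment -/

namespace LipPath

variable (γ : LipPath)

theorem continuousOn : ContinuousOn γ.toFun (Icc 0 γ.T) :=
  let ⟨_, hK⟩ := γ.lipschitz
  hK.continuousOn

theorem eVariationOn_ne_top {s t : ℝ} (hs : 0 ≤ s) (ht : t ≤ γ.T) :
    eVariationOn γ.toFun (Icc s t) ≠ ⊤ := by
  obtain ⟨K, hK⟩ := γ.lipschitz
  have h := hK.locallyBoundedVariationOn 0 γ.T ⟨le_rfl, γ.T_nonneg⟩ ⟨γ.T_nonneg, le_rfl⟩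
  rw [inter_self] at h
  exact h.mono (Icc_subset_Icc hs ht)

theorem lengthUpTo_sub {s t : ℝ} (hs : 0 ≤ s) (hst : s ≤ t) (ht : t ≤ γ.T) :
    (γ.lengthUpTo t : ℝ) - γ.lengthUpTo s = (eVariationOn γ.toFun (Icc s t)).toReal := by
  have h := eVariationOn.Icc_add_Icc γ.toFun (s := univ) hs hst (mem_univ s)
  simp only [univ_inter] at h
  simp only [lengthUpTo, ENNReal.coe_toNNReal_eq_toReal, ← h]
  rw [ENNReal.toReal_add (γ.eVariationOn_ne_top le_rfl (hst.trans ht))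
    (γ.eVariationOn_ne_top hs ht), add_sub_cancel_left]

theorem dist_le_lengthUpTo_sub {s t : ℝ} (hs : 0 ≤ s) (hst : s ≤ t) (ht : t ≤ γ.T) :
    dist (γ.toFun s) (γ.toFun t) ≤ γ.lengthUpTo t - γ.lengthUpTo s := by
  rw [γ.lengthUpTo_sub hs hst ht, dist_edist]
  exact ENNReal.toReal_mono (γ.eVariationOn_ne_top hs ht)
    (eVariationOn.edist_le _ ⟨le_rfl, hst⟩ ⟨hst, le_rfl⟩)

theorem lengthUpTo_zero : γ.lengthUpTo 0 = 0 := by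
  simp [lengthUpTo, eVariationOn.subsingleton]

theorem lengthUpTo_mono {s t : ℝ} (hs : 0 ≤ s) (hst : s ≤ t) (ht : t ≤ γ.T) :
    γ.lengthUpTo s ≤ γ.lengthUpTo t := by
  have := dist_nonneg.trans (γ.dist_le_lengthUpTo_sub hs hst ht)
  exact_mod_cast sub_nonneg.1 this

theorem norm_le_lengthUpTo {t : ℝ} (ht : t ∈ Icc 0 γ.T) : ‖γ.toFun t‖ ≤ γ.lengthUpTo t := by
  have := γ.dist_le_lengthUpTo_sub le_rfl ht.1 ht.2
  simpa [γ.map_zero, γ.lengthUpTo_zero] using this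

theorem eVariationOn_Icc_le {f : ℝ → ℂ} {K : ℝ≥0} {a b : ℝ} (h : LipschitzOnWith K f (Icc a b))
    (hab : a ≤ b) : eVariationOn f (Icc a b) ≤ K * ENNReal.ofReal (b - a) := by
  have h1 := h.comp_eVariationOn_le (g := fun x : ℝ => x) (mapsTo_id _)
  have h2 := (monotone_id.monotoneOn (Icc a b)).eVariationOn_eq (left_mem_Icc.2 hab)
    (right_mem_Icc.2 hab)
  rw [inter_self] at h2
  exact h1.trans (mul_le_mul_right h2.le _)

theorem lengthUpTo_continuousOn : ContinuousOn γ.lengthUpTo (Icc 0 γ.T) := by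
  obtain ⟨K, hK⟩ := γ.lipschitz
  refine LipschitzOnWith.continuousOn (K := K) (LipschitzOnWith.of_dist_le_mul ?_)
  have key : ∀ s t : ℝ, 0 ≤ s → s ≤ t → t ≤ γ.T →
      dist (γ.lengthUpTo s) (γ.lengthUpTo t) ≤ K * dist s t := by
    intro s t hs hst ht
    rw [dist_comm, NNReal.dist_eq, dist_comm s, Real.dist_eq, abs_of_nonneg (sub_nonneg.2 hst),
      γ.lengthUpTo_sub hs hst ht, abs_of_nonneg ENNReal.toReal_nonneg]
    have := eVariationOn_Icc_le (hK.mono (Icc_subset_Icc hs ht)) hst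
    have h2 := ENNReal.toReal_mono (by finiteness) this
    rwa [ENNReal.toReal_mul, ENNReal.toReal_ofReal (sub_nonneg.2 hst), ENNReal.coe_toReal] at h2
  intro s hs t ht
  rcases le_total s t with hst | hst
  · exact key s t hs.1 hst ht.2
  · rw [dist_comm, dist_comm s]
    exact key t s ht.1 hst hs.2

/-- The constant path on `[0, 0]`. -/
def trivial : LipPath where
  T := 0
  T_nonneg := le_rfl
  toFun _ := 0
  lipschitz := ⟨0, (LipschitzWith.const 0).lipschitzOnWith⟩
  map_zero := rfl

/-- The path `γ` followed by the straight segment from its end point to `z`. -/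
def snoc (z : ℂ) : LipPath where
  T := γ.T + 1
  T_nonneg := add_nonneg γ.T_nonneg zero_le_one
  toFun t := γ.toFun (min t γ.T) + (max t γ.T - γ.T) • (z - γ.toFun γ.T)
  lipschitz := by
    obtain ⟨K, hK⟩ := γ.lipschitz
    have h1 : LipschitzOnWith 1 (fun t => min t γ.T) (Icc 0 (γ.T + 1)) :=
      (LipschitzWith.id.min_const γ.T).lipschitzOnWith
    have h2 : LipschitzOnWith 1 (fun t => max t γ.T) (Icc 0 (γ.T + 1)) :=
      (LipschitzWith.id.max_const γ.T).lipschitzOnWith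
    have h3 : LipschitzWith ‖z - γ.toFun γ.T‖₊ fun t : ℝ => (t - γ.T) • (z - γ.toFun γ.T) := by
      refine LipschitzWith.of_dist_le_mul fun s t => ?_
      rw [dist_eq_norm, ← sub_smul, norm_smul, sub_sub_sub_cancel_right, mul_comm, dist_eq_norm]
      rfl
    exact ⟨_, (hK.comp h1 fun t ht => ⟨le_min ht.1 γ.T_nonneg, min_le_right _ _⟩).add
      (h3.comp_lipschitzOnWith h2)⟩
  map_zero := by simp [γ.T_nonneg, γ.map_zero]

variable {γ}

theorem snoc_of_le (z : ℂ) {t : ℝ} (ht : t ≤ γ.T) : (γ.snoc z).toFun t = γ.toFun t := by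
  simp [snoc, ht]

theorem snoc_of_ge (z : ℂ) {t : ℝ} (ht : γ.T ≤ t) :
    (γ.snoc z).toFun t = AffineMap.lineMap (γ.toFun γ.T) z (t - γ.T) := by
  simp [snoc, ht, AffineMap.lineMap_apply_module', add_comm]

theorem snoc_end (z : ℂ) : (γ.snoc z).toFun (γ.snoc z).T = z := by
  rw [snoc_of_ge z (by simp [snoc])]
  simp [snoc]

theorem length_snoc_le (z : ℂ) :
    ((γ.snoc z).length : ℝ) ≤ γ.length + dist (γ.toFun γ.T) z := by
  have hT : (γ.snoc z).T = γ.T + 1 := rfl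
  have h := (γ.snoc z).lengthUpTo_sub γ.T_nonneg (t := γ.T + 1) (by linarith) hT.ge
  have h1 : (γ.snoc z).lengthUpTo γ.T = γ.length := by
    simp only [length, lengthUpTo]
    rw [eVariationOn.congr fun t ht => snoc_of_le z ht.2]
  have h2 : eVariationOn (γ.snoc z).toFun (Icc γ.T (γ.T + 1)) ≤ edist (γ.toFun γ.T) z := by
    rw [eVariationOn.congr fun t ht => snoc_of_ge z ht.1]
    have h3 : LipschitzOnWith (nndist (γ.toFun γ.T) z)
        (fun t : ℝ => (AffineMap.lineMap (γ.toFun γ.T) z (t - γ.T) : ℂ)) (Icc γ.T (γ.T + 1)) := by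
      refine LipschitzOnWith.of_dist_le_mul fun s _ t _ => ?_
      rw [dist_lineMap_lineMap, dist_sub_right, mul_comm]
      rfl
    have h4 := eVariationOn_Icc_le h3 (by linarith)
    rwa [add_sub_cancel_left, ENNReal.ofReal_one, mul_one, ← edist_nndist] at h4
  have h4 := ENNReal.toReal_mono (edist_ne_top _ _) h2
  rw [← h, h1, ← dist_edist] at h4
  have : (γ.snoc z).length = (γ.snoc z).lengthUpTo (γ.T + 1) := rfl
  rw [this]
  linarith

end LipPath

/-! ### Germs reached while avoiding a set -/

/-- The germ of `g` at `q` is obtained from `φ` by continuation along a path of length `< ℓ`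
which avoids `S` after time `0`. -/
def Reaches (φ : ℂ⟦X⟧) (S : Set ℂ) (q : ℂ) (ℓ : ℝ) (g : ℂ → ℂ) : Prop :=
  ∃ γ : LipPath, γ.toFun γ.T = q ∧ (γ.length : ℝ) < ℓ ∧ (∀ t ∈ Ioc 0 γ.T, γ.toFun t ∉ S) ∧
    ∃ F, IsGermContinuation γ.toFun 0 γ.T F ∧ F 0 =ᶠ[𝓝 0] evalSum φ ∧ F γ.T =ᶠ[𝓝 q] g

namespace Reaches

variable {φ : ℂ⟦X⟧} {S : Set ℂ} {q z : ℂ} {ℓ ℓ' : ℝ} {g g' : ℂ → ℂ}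

theorem mono (h : Reaches φ S q ℓ g) (hl : ℓ ≤ ℓ') : Reaches φ S q ℓ' g :=
  let ⟨γ, h1, h2, h3⟩ := h
  ⟨γ, h1, h2.trans_le hl, h3⟩

theorem congr (h : Reaches φ S q ℓ g) (hg : g =ᶠ[𝓝 q] g') : Reaches φ S q ℓ g' :=
  let ⟨γ, h1, h2, h3, F, h4, h5, h6⟩ := h
  ⟨γ, h1, h2, h3, F, h4, h5, h6.trans hg⟩

theorem zero (hφ : AnalyticAt ℂ (evalSum φ) 0) (hl : 0 < ℓ) : Reaches φ S 0 ℓ (evalSum φ) := by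
  refine ⟨LipPath.trivial, rfl, ?_, fun t ht => absurd ht.1 (not_lt.2 ht.2), fun _ => evalSum φ,
    IsGermContinuation.const fun _ _ => hφ, EventuallyEq.rfl, EventuallyEq.rfl⟩
  have : LipPath.trivial.length = 0 := LipPath.lengthUpTo_zero _
  simpa [this] using hl

theorem snoc_avoids {γ : LipPath} (h : ∀ t ∈ Ioc 0 γ.T, γ.toFun t ∉ S)
    (hz : ∀ t ∈ Ioc (0 : ℝ) 1, (AffineMap.lineMap (γ.toFun γ.T) z t : ℂ) ∉ S) :
    ∀ t ∈ Ioc 0 (γ.snoc z).T, (γ.snoc z).toFun t ∉ S := by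
  intro t ht
  rcases le_or_gt t γ.T with h' | h'
  · rw [LipPath.snoc_of_le z h']
    exact h t ⟨ht.1, h'⟩
  · rw [LipPath.snoc_of_ge z h'.le]
    exact hz _ ⟨sub_pos.2 h', by have : t ≤ γ.T + 1 := ht.2; linarith⟩

theorem snoc (h : Reaches φ S q ℓ g) {U : Set ℂ} (hU : Convex ℝ U) (hg : AnalyticOnNhd ℂ g U)
    (hq : q ∈ U) (hzU : z ∈ U)
    (hz : ∀ t ∈ Ioc (0 : ℝ) 1, (AffineMap.lineMap q z t : ℂ) ∉ S) :
    Reaches φ S z (ℓ + dist q z) g := by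
  obtain ⟨γ, rfl, h2, h3, F, h4, h5, h6⟩ := h
  have hle : γ.T ≤ (γ.snoc z).T := by simp [LipPath.snoc]
  have hF : IsGermContinuation (γ.snoc z).toFun 0 γ.T F := by
    constructor
    · intro t ht
      rw [LipPath.snoc_of_le z ht.2]
      exact h4.analyticAt t ht
    · intro t ht
      filter_upwards [h4.eventually_eq t ht, self_mem_nhdsWithin] with s hs hsI
      rwa [LipPath.snoc_of_le z hsI.2]
  have hG : IsGermContinuation (γ.snoc z).toFun γ.T (γ.snoc z).T fun _ => g := by
    refine IsGermContinuation.const fun t ht => hg _ ?_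
    rw [LipPath.snoc_of_ge z ht.1]
    have : t ≤ γ.T + 1 := ht.2
    exact hU.lineMap_mem hq hzU ⟨sub_nonneg.2 ht.1, by linarith⟩
  refine ⟨γ.snoc z, LipPath.snoc_end z, ?_, snoc_avoids h3 hz, _,
    IsGermContinuation.concat (γ.snoc z).continuousOn hF hG ?_, ?_, ?_⟩
  · linarith [LipPath.length_snoc_le (γ := γ) z]
  · rwa [LipPath.snoc_of_le z le_rfl]
  · simpa only [if_pos γ.T_nonneg] using h5
  · have : ¬ (γ.snoc z).T ≤ γ.T := by simp [LipPath.snoc]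
    simp only [if_neg this]
    exact EventuallyEq.rfl

end Reaches

/-! ### Detours around a finite set -/

open AffineMap in
theorem lineMap_mem_ball {q m : ℂ} {r : ℝ} (hm : dist q m < r) {t : ℝ} (ht : t ∈ Icc (0 : ℝ) 1) :
    (lineMap q m t : ℂ) ∈ Metric.ball q r :=
  (convex_ball q r).lineMap_mem
    (Metric.mem_ball_self (dist_nonneg.trans_lt hm)) (by rwa [Metric.mem_ball, dist_comm]) ht

open AffineMap in
/-- Two points off a finite set can be joined in its complement by two segments, the first of which
is arbitrarily short. -/
theorem exists_detour {S : Set ℂ} (hS : S.Finite) {q q' : ℂ} (hq : q ∉ S) (hq' : q' ∉ S)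
    (hne : q ≠ q') {η : ℝ} (hη : 0 < η) :
    ∃ m : ℂ, dist q m < η ∧ (∀ t ∈ Icc (0 : ℝ) 1, (lineMap q m t : ℂ) ∉ S) ∧
      ∀ t ∈ Icc (0 : ℝ) 1, (lineMap m q' t : ℂ) ∉ S := by
  obtain ⟨ρ, hρ, hρS⟩ := Metric.isOpen_iff.1 hS.isClosed.isOpen_compl q hq
  let m : ℝ → ℂ := fun s => q + s * (Complex.I * (q' - q))
  have hm : Tendsto m (𝓝[≠] 0) (𝓝 q) := by
    have : Continuous m := by fun_prop
    have h0 : m 0 = q := by simp [m]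
    exact (h0 ▸ this.tendsto 0).mono_left nhdsWithin_le_nhds
  have hbad : {s : ℝ | ∃ t : ℝ, (lineMap (m s) q' t : ℂ) ∈ S}.Finite := by
    have : {s : ℝ | ∃ t : ℝ, (lineMap (m s) q' t : ℂ) ∈ S} ⊆
        (fun f => -((f - q') / (q - q')).im / ((f - q') / (q - q')).re) '' S := by
      rintro s ⟨t, ht⟩
      refine ⟨_, ht, ?_⟩
      have hd : q - q' ≠ 0 := sub_ne_zero.2 hne
      have hw : ((lineMap (m s) q' t : ℂ) - q') / (q - q') =
          ((1 - t : ℝ) : ℂ) * (1 - s * Complex.I) := by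
        rw [div_eq_iff hd, lineMap_apply_module', Complex.real_smul]
        simp only [m]
        push_cast
        ring
      have ht1 : 1 - t ≠ 0 := by
        intro h
        have : t = 1 := by linarith
        rw [this, lineMap_apply_one] at ht
        exact hq' ht
      simp only [hw]
      simp
      field_simp
    exact (hS.image _).subset this
  have h1 : ∀ᶠ s in 𝓝[≠] (0 : ℝ), s ∉ {s : ℝ | ∃ t : ℝ, (lineMap (m s) q' t : ℂ) ∈ S} :=
    nhdsNE_le_cofinite _ hbad.compl_mem_cofinite
  obtain ⟨s, hs1, hs2⟩ := (h1.and (hm.eventually (Metric.ball_mem_nhds q (lt_min hη hρ)))).exists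
  rw [dist_comm] at hs2
  refine ⟨m s, hs2.trans_le (min_le_left _ _), fun t ht => ?_, fun t _ h => hs1 ⟨t, h⟩⟩
  exact hρS (lineMap_mem_ball (hs2.trans_le (min_le_right _ _)) ht)

namespace Reaches

variable {φ : ℂ⟦X⟧} {S : Set ℂ} {q z : ℂ} {ℓ : ℝ} {g : ℂ → ℂ}

/-- Moving inside a disc on which the germ is analytic costs little more than the distance. -/
theorem move (hS : S.Finite) (h : Reaches φ S q ℓ g) {c : ℂ} {r : ℝ}
    (hg : AnalyticOnNhd ℂ g (Metric.ball c r)) (hqc : q ∈ Metric.ball c r)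
    (hzc : z ∈ Metric.ball c r) (hq : q ∉ S) (hz : z ∉ S) {ε : ℝ} (hε : 0 < ε) :
    Reaches φ S z (ℓ + dist q z + ε) g := by
  by_cases hne : q = z
  · subst hne
    exact h.mono (by simp [hε.le])
  obtain ⟨ρ, hρ, hρU⟩ := Metric.isOpen_iff.1 Metric.isOpen_ball q hqc
  obtain ⟨m, hm, hm1, hm2⟩ := exists_detour hS hq hz hne (lt_min (half_pos hε) hρ)
  have hmc : m ∈ Metric.ball c r := hρU (by
    rw [Metric.mem_ball, dist_comm]; exact hm.trans_le (min_le_right _ _))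
  refine ((h.snoc (convex_ball _ _) hg hqc hmc fun t ht => hm1 t ⟨ht.1.le, ht.2⟩).snoc
    (convex_ball _ _) hg hmc hzc fun t ht => hm2 t ⟨ht.1.le, ht.2⟩).mono ?_
  have h1 := hm.trans_le (min_le_left _ _)
  have h2 := dist_triangle m q z
  rw [dist_comm m q] at h2
  linarith

/-- The origin may belong to `S`, since `Reaches` ignores time `0`. In a small disc only the origin
can be in `S`, and the segment from `0` to `q ≠ 0` never returns to it. -/
theorem eventually_near_zero (hS : S.Finite) (hφ : AnalyticAt ℂ (evalSum φ) 0) {ε : ℝ}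
    (hε : 0 < ε) : ∀ᶠ q in 𝓝[Sᶜ] 0, Reaches φ S q ε (evalSum φ) := by
  obtain ⟨r, hr, hφr⟩ := hφ.exists_ball_analyticOnNhd
  have hS' : (S \ {0}).Finite := hS.subset sdiff_subset
  obtain ⟨ρ, hρ, hρS⟩ := Metric.isOpen_iff.1 hS'.isClosed.isOpen_compl 0 (by simp)
  filter_upwards [self_mem_nhdsWithin, nhdsWithin_le_nhds (Metric.ball_mem_nhds 0 hr),
    nhdsWithin_le_nhds (Metric.ball_mem_nhds 0 hρ),
    nhdsWithin_le_nhds (Metric.ball_mem_nhds 0 (half_pos hε))] with q hqS hqr hqρ hqε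
  refine ((zero hφ (half_pos hε)).snoc (convex_ball 0 r) hφr (Metric.mem_ball_self hr) hqr
    fun t ht hmem => ?_).mono ?_
  · have h1 := hρS (lineMap_mem_ball (by rwa [dist_comm]) ⟨ht.1.le, ht.2⟩)
    have h2 : (AffineMap.lineMap (0 : ℂ) q t : ℂ) = 0 := by
      by_contra h3
      exact h1 ⟨hmem, h3⟩
    rw [h2] at hmem
    rw [AffineMap.lineMap_apply_module'] at h2
    have h3 : q = 0 := by simpa [ht.1.ne'] using h2
    exact hqS (h3 ▸ hmem)
  · rw [Metric.mem_ball, dist_comm] at hqε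
    linarith

/-- Germs obtained by continuation along a path which may meet the finite set `S` are also obtained
along paths avoiding `S` of almost the same length. -/
theorem of_continuation (hS : S.Finite) (hφ : AnalyticAt ℂ (evalSum φ) 0) (γ : LipPath) {τ : ℝ}
    (hτ : τ ≤ γ.T) {F : ℝ → ℂ → ℂ} (hF : IsGermContinuation γ.toFun 0 τ F)
    (hF0 : F 0 =ᶠ[𝓝 0] evalSum φ) :
    ∀ t ∈ Icc 0 τ, ∀ ε > 0, ∀ᶠ q in 𝓝[Sᶜ] (γ.toFun t),
      Reaches φ S q (γ.lengthUpTo t + ε) (F t) := by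
  refine forward_induction_Icc (fun ε hε => ?_) fun t ht => ?_
  · rw [γ.map_zero, γ.lengthUpTo_zero]
    filter_upwards [eventually_near_zero hS hφ hε,
      nhdsWithin_le_nhds (eventually_eventually_nhds.2 hF0)] with q hq hq0
    simpa using hq.congr (EventuallyEq.symm hq0)
  · obtain ⟨r, hr, hFr⟩ := (hF.analyticAt t ht).exists_ball_analyticOnNhd
    refine ⟨_, (eventually_mem_ball_of_continuousOn (γ.continuousOn.mono
      (Icc_subset_Icc_right hτ)) ht hr).and (hF.eventually_eq t ht), ?_⟩
    rintro s ⟨hs, hFs⟩ s' ⟨hs', hFs'⟩ hsI hsI' hss' hP ε hε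
    have : (𝓝[Sᶜ] (γ.toFun s)).NeBot :=
      mem_closure_iff_nhdsWithin_neBot.1 (hS.countable.dense_compl ℝ _)
    have hε8 : 0 < ε / 8 := by positivity
    -- A reached point `q` off `S` near `γ s` is moved to `z` near `γ s'`. The reach, the two
    -- offsets and the detour each cost `ε / 8`; the induction claim holds for every `ε`, so these
    -- losses do not accumulate.
    obtain ⟨q, hq, hqS, hqr, hqε, hqF⟩ := ((hP (ε / 8) hε8).and
      (eventually_mem_nhdsWithin.and (eventually_nhdsWithin_of_eventually_nhds
        ((Metric.isOpen_ball.eventually_mem hs).and (((Metric.isOpen_ball.eventually_mem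
          (Metric.mem_ball_self hε8))).and (eventually_eventually_nhds.2 hFs)))))).exists
    filter_upwards [self_mem_nhdsWithin, nhdsWithin_le_nhds (Metric.isOpen_ball.mem_nhds hs'),
      nhdsWithin_le_nhds (Metric.ball_mem_nhds _ hε8),
      nhdsWithin_le_nhds (eventually_eventually_nhds.2 hFs')] with z hzS hzr hzε hzF
    refine (((hq.congr hqF).move hS hFr hqr hzr hqS hzS hε8).mono ?_).congr (EventuallyEq.symm hzF)
    have h1 := γ.dist_le_lengthUpTo_sub hsI.1 hss' (hsI'.2.trans hτ)
    have h2 := dist_triangle4 q (γ.toFun s) (γ.toFun s') z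
    have hqε' : dist q (γ.toFun s) < ε / 8 := hqε
    rw [Metric.mem_ball, dist_comm] at hzε
    linarith

/-- If `φ` can be continued along all paths of length `< N` avoiding `S`, then a germ reached
before length `N` extends to a disc free of points of `S`. -/
theorem exists_extension {N R : ℝ}
    (hN : ∀ γ : LipPath, 0 < γ.T → (γ.length : ℝ) < N → (∀ t ∈ Ioc 0 γ.T, γ.toFun t ∉ S) →
      ContinuableAlong φ γ)
    (h : Reaches φ S q ℓ g) (hR : 0 < R) (hRS : Metric.ball q R ⊆ Sᶜ) (hl : ℓ + R ≤ N) :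
    ∃ G, AnalyticOnNhd ℂ G (Metric.ball q R) ∧ G =ᶠ[𝓝 q] g := by
  obtain ⟨γ, rfl, h2, h3, F, h4, h5, h6⟩ := h
  refine exists_analyticOnNhd_ball hR fun z hz => ?_
  rw [Metric.mem_ball, dist_comm] at hz
  have hT : (γ.snoc z).T = γ.T + 1 := rfl
  obtain ⟨H, hH1, hH2, hH3⟩ := hN (γ.snoc z) (by linarith [γ.T_nonneg])
    (by linarith [LipPath.length_snoc_le (γ := γ) z])
    (snoc_avoids h3 fun t ht => hRS (lineMap_mem_ball hz ⟨ht.1.le, ht.2⟩))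
  have hH : IsGermContinuation (γ.snoc z).toFun 0 (γ.snoc z).T H := ⟨hH1, hH3⟩
  have hH' : IsGermContinuation γ.toFun 0 γ.T H := by
    have := hH.mono le_rfl (show γ.T ≤ (γ.snoc z).T by linarith)
    constructor
    · intro t ht
      have := this.analyticAt t ht
      rwa [LipPath.snoc_of_le z ht.2] at this
    · intro t ht
      filter_upwards [this.eventually_eq t ht, self_mem_nhdsWithin] with s hs hsI
      rwa [LipPath.snoc_of_le z hsI.2] at hs
  -- The hypothesis restarts from `φ`; uniqueness along `γ` shows that each radial continuation does
  -- start from `g`.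
  have hHF := IsGermContinuation.unique γ.continuousOn hH' h4
    (by rw [γ.map_zero]; exact hH2.trans h5.symm) γ.T ⟨γ.T_nonneg, le_rfl⟩
  have hmaps : MapsTo (fun t : ℝ => γ.T + t) (Icc 0 1) (Icc 0 (γ.snoc z).T) := fun t ht =>
    ⟨add_nonneg γ.T_nonneg ht.1, by rw [hT]; linarith [ht.2]⟩
  have hpt : ∀ t ∈ Icc (0 : ℝ) 1, (γ.snoc z).toFun (γ.T + t) =
      AffineMap.lineMap (γ.toFun γ.T) z t := fun t ht => by
    rw [LipPath.snoc_of_ge z (by linarith [ht.1]), add_sub_cancel_left]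
  refine ⟨fun t => H (γ.T + t), ⟨fun t ht => ?_, fun t ht => ?_⟩, ?_⟩
  · rw [← hpt t ht]
    exact hH1 _ (hmaps ht)
  · have hcont : ContinuousWithinAt (fun t : ℝ => γ.T + t) (Icc 0 1) t :=
      (continuous_const.add continuous_id).continuousWithinAt
    filter_upwards [(hcont.tendsto_nhdsWithin hmaps).eventually (hH3 _ (hmaps ht)),
      self_mem_nhdsWithin] with s hs hsI
    rwa [hpt s hsI] at hs
  · simpa only [add_zero] using hHF.trans h6

end Reaches

/-! ### Reparametrization and the two inclusions -/

/-- Continuability does not depend on the length of the parameter interval. -/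
theorem continuableAlong_of_unit {φ : ℂ⟦X⟧} {S : Set ℂ} {N : ℝ}
    (h : ∀ γ : LipPath, γ.T = 1 → (γ.length : ℝ) < N → (∀ t ∈ Ioc (0 : ℝ) 1, γ.toFun t ∉ S) →
      ContinuableAlong φ γ) (γ : LipPath) (hT : 0 < γ.T) (hN : (γ.length : ℝ) < N)
    (hS : ∀ t ∈ Ioc 0 γ.T, γ.toFun t ∉ S) : ContinuableAlong φ γ := by
  have hmaps : MapsTo (fun t : ℝ => t * γ.T) (Icc 0 1) (Icc 0 γ.T) := fun t ht =>
    ⟨mul_nonneg ht.1 hT.le, mul_le_of_le_one_left hT.le ht.2⟩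
  let γ' : LipPath :=
    { T := 1
      T_nonneg := zero_le_one
      toFun := fun t => γ.toFun (t * γ.T)
      lipschitz := by
        obtain ⟨K, hK⟩ := γ.lipschitz
        have h1 : LipschitzWith ‖γ.T‖₊ fun t : ℝ => t * γ.T := by
          refine LipschitzWith.of_dist_le_mul fun s t => ?_
          rw [dist_eq_norm, ← sub_mul, norm_mul, mul_comm, dist_eq_norm]
          rfl
        exact ⟨_, hK.comp h1.lipschitzOnWith hmaps⟩
      map_zero := by simp [γ.map_zero] }
  have hlen : γ'.length ≤ γ.length :=
    ENNReal.toNNReal_mono (γ.eVariationOn_ne_top le_rfl le_rfl)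
      (eVariationOn.comp_le_of_monotoneOn γ.toFun (fun t => t * γ.T)
        (fun s _ t _ hst => mul_le_mul_of_nonneg_right hst hT.le) hmaps)
  obtain ⟨F, h1, h2, h3⟩ := h γ' rfl (lt_of_le_of_lt (by exact_mod_cast hlen) hN)
    fun t ht => hS _ ⟨mul_pos ht.1 hT, mul_le_of_le_one_left hT.le ht.2⟩
  have hmaps' : MapsTo (fun t : ℝ => t / γ.T) (Icc 0 γ.T) (Icc 0 γ'.T) := fun t ht =>
    ⟨div_nonneg ht.1 hT.le, div_le_one_of_le₀ ht.2 hT.le⟩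
  have hpt : ∀ t, γ'.toFun (t / γ.T) = γ.toFun t := fun t => by
    simp only [γ', div_mul_cancel₀ _ hT.ne']
  refine ⟨fun t => F (t / γ.T), fun t ht => ?_, by simpa using h2, fun t ht => ?_⟩
  · rw [← hpt]
    exact h1 _ (hmaps' ht)
  · have hcont : ContinuousWithinAt (fun t : ℝ => t / γ.T) (Icc 0 γ.T) t :=
      (continuous_id.div_const _).continuousWithinAt
    filter_upwards [(hcont.tendsto_nhdsWithin hmaps').eventually (h3 _ (hmaps' ht))] with s hs
    rwa [hpt] at hs

theorem analyticAt_evalSum {φ : ℂ⟦X⟧} (hφ : IsConvergent φ) : AnalyticAt ℂ (evalSum φ) 0 :=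
  ((toFMS φ).hasFPowerSeriesOnBall hφ).analyticAt

/-- `Ω_L` is closed and contains all earlier levels, so the open set `[0, L) × (ℂ \ Ω_L)` misses the
graph. -/
theorem DiscreteFilteredSet.mem_of_mem_closure_graph (Ω : DiscreteFilteredSet) {l L : ℝ≥0} {w : ℂ}
    (hl : l < L) (h : (l, w) ∈ closure Ω.graph) : w ∈ Ω.carrier L := by
  have hclosed : IsClosed (Ω.carrier L) := (Ω.finite L).isClosed
  by_contra hw
  have hU : Iio L ×ˢ (Ω.carrier L)ᶜ ∈ 𝓝 (l, w) :=
    prod_mem_nhds (Iio_mem_nhds hl) (hclosed.isOpen_compl.mem_nhds hw)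
  obtain ⟨⟨l', w'⟩, ⟨hl', hw'⟩, hmem⟩ := mem_closure_iff_nhds.1 h _ hU
  exact hw' (Ω.mono _ _ (le_of_lt hl') hmem)

theorem continuable_subset_endlesslyContinuable (Ω : DiscreteFilteredSet) :
    Continuable Ω ⊆ EndlesslyContinuable := by
  rintro φ ⟨hφ, h⟩
  refine ⟨hφ, fun L hL => ⟨Ω.carrier L.toNNReal, Ω.finite _, fun γ hT hlen hav => h γ ?_⟩⟩
  intro t ht hmem
  -- Avoidance is not assumed at time `0`; there the level `δ` with `Ω_δ = ∅` is used instead.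
  rcases ht.1.eq_or_lt with rfl | h0
  · obtain ⟨δ, hδ, hempty⟩ := Ω.exists_empty
    rw [γ.lengthUpTo_zero] at hmem
    have := Ω.mem_of_mem_closure_graph hδ hmem
    rw [hempty] at this
    exact this
  · have hlt : γ.lengthUpTo t < L.toNNReal := by
      refine (γ.lengthUpTo_mono ht.1 ht.2 le_rfl).trans_lt ?_
      exact Real.lt_toNNReal_iff_coe_lt.2 hlen
    exact hav t ⟨h0, hT ▸ ht.2⟩ (Ω.mem_of_mem_closure_graph hlt hmem)

/-- The discrete filtered set which is empty below `δ` and collects the sets `S k` for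
`k ≤ L + 2` at each `L ≥ δ`. -/
def filteredUnion (δ : ℝ≥0) (hδ : 0 < δ) (S : ℕ → Set ℂ) (hS : ∀ k, (S k).Finite) :
    DiscreteFilteredSet where
  carrier L := {w | δ ≤ L ∧ ∃ k ≤ ⌊L⌋₊ + 2, w ∈ S k}
  finite L := by
    refine ((finite_Iic (⌊L⌋₊ + 2)).biUnion fun k _ => hS k).subset ?_
    rintro w ⟨-, k, hk, hw⟩
    exact mem_biUnion hk hw
  mono L₁ L₂ h := by
    rintro w ⟨h1, k, hk, hw⟩
    exact ⟨h1.trans h, k, hk.trans (Nat.add_le_add_right (Nat.floor_mono h) 2), hw⟩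
  exists_empty := ⟨δ / 2, half_pos hδ,
    eq_empty_of_forall_notMem fun _ hw => (half_lt_self hδ).not_ge hw.1⟩

theorem exists_continuable {φ : ℂ⟦X⟧} (h : φ ∈ EndlesslyContinuable) :
    ∃ Ω : DiscreteFilteredSet, φ ∈ Continuable Ω := by
  obtain ⟨hφ, h⟩ := h
  have hφ0 := analyticAt_evalSum hφ
  obtain ⟨δ, hδ, hφδ⟩ := hφ0.exists_ball_analyticOnNhd
  have h' : ∀ k : ℕ, ∃ F : Set ℂ, F.Finite ∧ ∀ γ : LipPath, γ.T = 1 → (γ.length : ℝ) < k →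
      (∀ t ∈ Ioc (0 : ℝ) 1, γ.toFun t ∉ F) → ContinuableAlong φ γ := by
    intro k
    rcases k.eq_zero_or_pos with rfl | hk
    · refine ⟨∅, finite_empty, fun γ _ hlen => absurd hlen (not_lt.2 ?_)⟩
      simp
    · exact h k (by exact_mod_cast hk)
  choose S hSfin hS using h'
  refine ⟨filteredUnion ⟨δ, hδ.le⟩ hδ S hSfin, hφ, fun γ hγ => ?_⟩
  suffices hQ : ∀ t ∈ Icc 0 γ.T, ∃ F, IsGermContinuation γ.toFun 0 t F ∧
      F 0 =ᶠ[𝓝 0] evalSum φ by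
    obtain ⟨F, hF, hF0⟩ := hQ γ.T ⟨γ.T_nonneg, le_rfl⟩
    exact ⟨F, hF.analyticAt, hF0, hF.eventually_eq⟩
  refine forward_induction_Icc ⟨fun _ => evalSum φ, IsGermContinuation.const fun t ht => ?_,
    EventuallyEq.rfl⟩ fun t ht => ?_
  · rwa [le_antisymm ht.2 ht.1, γ.map_zero]
  -- Below length `δ` the path stays in the disc where the sum of `φ` is analytic.
  by_cases hsmall : (γ.lengthUpTo t : ℝ) < δ
  · have hev : ∀ᶠ s in 𝓝[Icc 0 γ.T] t, γ.lengthUpTo s < ⟨δ, hδ.le⟩ :=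
      (γ.lengthUpTo_continuousOn t ht).eventually (eventually_lt_nhds hsmall)
    refine ⟨_, hev, ?_⟩
    rintro s - s' hs' - hsI' - -
    refine ⟨fun _ => evalSum φ, IsGermContinuation.const fun σ hσ => hφδ _ ?_, EventuallyEq.rfl⟩
    have h1 := γ.norm_le_lengthUpTo ⟨hσ.1, hσ.2.trans hsI'.2⟩
    have h2 : (γ.lengthUpTo σ : ℝ) ≤ γ.lengthUpTo s' := γ.lengthUpTo_mono hσ.1 hσ.2 hsI'.2
    have h3 : (γ.lengthUpTo s' : ℝ) < δ := hs'
    rw [mem_ball_zero_iff]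
    linarith
  · set N : ℕ := ⌊γ.lengthUpTo t⌋₊ + 2 with hNdef
    have hN : (γ.lengthUpTo t : ℝ) + 1 < N := by
      have : γ.lengthUpTo t < ⌊γ.lengthUpTo t⌋₊ + 1 := Nat.lt_floor_add_one _
      have : (γ.lengthUpTo t : ℝ) < ⌊γ.lengthUpTo t⌋₊ + 1 := by exact_mod_cast this
      rw [hNdef]
      push_cast
      linarith
    -- Only the current point is known to be off `S N`; earlier points need not be.
    have htS : γ.toFun t ∉ S N := fun hmem =>
      hγ t ht (subset_closure (show _ ∧ _ from ⟨not_lt.1 hsmall, N, le_rfl, hmem⟩))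
    obtain ⟨r, hr, hrS⟩ := Metric.isOpen_iff.1 (hSfin N).isClosed.isOpen_compl _ htS
    -- Discs of radius `R` centred within `R / 2` of `γ t` stay off `S N`. Three quarters are spent
    -- in length: the advance to `s`, the perturbation and `R`; the `+ 2` in `N` leaves room for
    -- more than `1`.
    obtain ⟨R, hR, hRr, hR1⟩ : ∃ R > 0, 2 * R ≤ r ∧ R ≤ 1 / 4 :=
      ⟨min (r / 2) (1 / 4), by positivity, by linarith [min_le_left (r / 2) (1 / 4)],
        min_le_right _ _⟩
    have hlen : ∀ᶠ s in 𝓝[Icc 0 γ.T] t, (γ.lengthUpTo s : ℝ) < γ.lengthUpTo t + 1 / 4 := by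
      have h1 : ContinuousWithinAt (fun s => (γ.lengthUpTo s : ℝ)) (Icc 0 γ.T) t :=
        NNReal.continuous_coe.continuousAt.comp_continuousWithinAt
          (γ.lengthUpTo_continuousOn t ht)
      exact h1.eventually (eventually_lt_nhds (by linarith))
    have hball := eventually_mem_ball_of_continuousOn γ.continuousOn ht (half_pos hR)
    -- Order-connectedness keeps the whole piece of path between `s` and `s'` within distance `R` of
    -- `γ s`.
    obtain ⟨V, hV, hVord, hVp⟩ : ∃ V ∈ 𝓝[Icc 0 γ.T] t, V.OrdConnected ∧ ∀ s ∈ V,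
        γ.toFun s ∈ Metric.ball (γ.toFun t) (R / 2) := by
      obtain ⟨ε, hε, hεV⟩ := Metric.mem_nhdsWithin_iff.1 hball
      refine ⟨_, inter_mem_nhdsWithin _ (Metric.ball_mem_nhds t hε), ?_, fun s hs => hεV hs.symm⟩
      exact ordConnected_Icc.inter (convex_ball t ε).ordConnected
    refine ⟨_, hlen.and hV, ?_⟩
    rintro s ⟨hs, hsV⟩ s' ⟨-, hsV'⟩ hsI hsI' hss' ⟨F, hF, hF0⟩
    have hsub : Metric.ball (γ.toFun s) R ⊆ (S N)ᶜ := by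
      refine (Metric.ball_subset_ball' ?_).trans hrS
      have : dist (γ.toFun s) (γ.toFun t) < R / 2 := hVp s hsV
      linarith
    have hreach : Reaches φ (S N) (γ.toFun s) (γ.lengthUpTo s + 1 / 4) (F s) :=
      (Reaches.of_continuation (hSfin N) hφ0 γ hsI.2 hF hF0 s ⟨hsI.1, le_rfl⟩ (1 / 4)
        (by norm_num)).self_of_nhdsWithin (hsub (Metric.mem_ball_self hR))
    obtain ⟨G, hG, hGs⟩ := hreach.exists_extension (continuableAlong_of_unit (hS N)) hR hsub
      (by linarith)
    refine ⟨_, IsGermContinuation.concat (γ.continuousOn.mono (Icc_subset_Icc_right hsI'.2)) hF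
      (G := fun _ => G) (IsGermContinuation.const fun σ hσ => hG _ ?_) hGs.symm, ?_⟩
    · have h1 : dist (γ.toFun s) (γ.toFun t) < R / 2 := hVp s hsV
      have h2 : dist (γ.toFun σ) (γ.toFun t) < R / 2 := hVp σ (hVord.out hsV hsV' hσ)
      rw [Metric.mem_ball]
      linarith [dist_triangle_right (γ.toFun σ) (γ.toFun s) (γ.toFun t)]
    · simpa only [if_pos hsI.1] using hF0

theorem endlesslyContinuable_eq_iUnion :
    EndlesslyContinuable = ⋃ Ω : DiscreteFilteredSet, Continuable Ω :=
  Subset.antisymm (fun _ h => mem_iUnion.2 (exists_continuable h))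
    (iUnion_subset continuable_subset_endlesslyContinuable)

end Resurgence
end

theorem proposition1 :
    (∀ φ : PowerSeries ℂ,
      φ ∈ Resurgence.Resurgent ↔
        ∃ Ω : Resurgence.DiscreteFilteredSet, φ ∈ Resurgence.ResurgentFor Ω) ∧
    Resurgence.EndlesslyContinuable =
      ⋃ Ω : Resurgence.DiscreteFilteredSet, Resurgence.Continuable Ω := by
  refine ⟨fun φ => ?_, Resurgence.endlesslyContinuable_eq_iUnion⟩
  simp [Resurgence.Resurgent, Resurgence.ResurgentFor, Resurgence.endlesslyContinuable_eq_iUnion]
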